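/- Let $[3]=\{1,2,3\}$. For $\beta>0$ and a finite graph $G=(V,E)$, the Gibbs distribution of the $3$-state Potts model on $G$ with parameter $\beta$ is the probability distribution on configurations $\sigma:V\to[3]$ that gives $\sigma$ a probability proportional to $\beta^{m(\sigma)}$, where $m(\sigma)$ is the number of edges of $G$ whose two endpoints have the same colour under $\sigma$. Let $\mathbb{T}_{d,n}$ be the $d$-ary tree of height $n$ (every path from the root to a leaf has $n$ edges and every non-leaf vertex has $d$ children), let $v_{d,n}$ be its root and $\Lambda_{d,n}$ its set of leaves. For $\tau:\Lambda_{d,n}\to[3]$ and $c\in[3]$ let \[ p_{d,n,\beta}(\tau,c)=\Pr\nolimits_{\mathbb{T}_{d,n}}\bigl[\sigma(v_{d,n})=c \,\big|\, \sigma|_{\Lambda_{d,n}}=\tau\bigr] \] be the conditional probability under the Gibbs distribution on $\mathbb{T}_{d,n}$ that the root has colour $c$ when the leaves are coloured by $\tau$. Then the following hold. (i) For every $\beta\in(0,1)$ there is $n_0$ such that, for all $n\ge n_0$, all $\tau:\Lambda_{2,n}\to[3]$ and all $c\in[3]$, \[ \frac{459}{2000}\le p_{2,n,\beta}(\tau,c)\le\frac{1107}{2500}.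 \] (ii) For every integer $d\ge 3$ and every $\beta\in\bigl[1-\tfrac{3}{d+1},1\bigr)$ there are sequences of real numbers $(L_n)$ and $(U_n)$, depending only on $d$ and $\beta$, and an $n_0$ such that, for all $n\ge n_0$, we have $L_n>0$, $U_n/L_n\le 53/27$, and \[ L_n\le p_{d,n,\beta}(\tau,c)\le U_n\quad\text{for all }\tau:\Lambda_{d,n}\to[3]\text{ and all }c\in[3]. \] -/

import Mathlib

open Filter

noncomputable section

namespace Potts

variable {V : Type*} {q : ℕ}

/-- The number `m(σ)` of monochromatic edges of `G` under the configuration `σ : V → [q]`. -/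
def monoEdges (G : SimpleGraph V) (σ : V → Fin q) : ℕ :=
  {e ∈ G.edgeSet | (e.map σ).IsDiag}.ncard

/-- The weight `β ^ m(σ)` of a configuration in the `q`-state Potts model with parameter `β`. -/
def weight (G : SimpleGraph V) (β : ℝ) (σ : V → Fin q) : ℝ :=
  β ^ monoEdges G σ

variable [Fintype V] [DecidableEq V]

/-- The partition function of the `q`-state Potts model on the finite graph `G`. -/
def partitionFunction (G : SimpleGraph V) (q : ℕ) (β : ℝ) : ℝ :=
  ∑ σ : V → Fin q, weight G β σ

/-- The mass `w(σ) / Z` that the Gibbs distribution gives to a configuration. -/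
def gibbsMass (G : SimpleGraph V) (β : ℝ) (σ : V → Fin q) : ℝ :=
  weight G β σ / partitionFunction G q β

/-- The probability of an event (a set of configurations) in the Gibbs distribution. -/
def prob (G : SimpleGraph V) (β : ℝ) (A : Set (V → Fin q)) : ℝ :=
  ∑ σ : V → Fin q, A.indicator (gibbsMass G β) σ

/-- The conditional probability of the event `A` given the event `B`
in the Gibbs distribution. -/
def condProb (G : SimpleGraph V) (β : ℝ) (A B : Set (V → Fin q)) : ℝ :=
  prob G β (A ∩ B) / prob G β B

end Potts

namespace DaryTree

/-- The vertices of the `d`-ary tree of height `n`. For height `0` there is only the root. For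
height `n + 1` there are the root `none` and, for each `i : Fin d`, the vertices
`some (i, v)` of the `i`-th of the `d` subtrees of height `n` that hang from the root. -/
def Vertex (d : ℕ) : ℕ → Type
  | 0 => Unit
  | n + 1 => Option (Fin d × Vertex d n)

instance instDecidableEqVertex (d : ℕ) : (n : ℕ) → DecidableEq (Vertex d n)
  | 0 => inferInstanceAs (DecidableEq Unit)
  | n + 1 =>
    haveI := instDecidableEqVertex d n
    inferInstanceAs (DecidableEq (Option (Fin d × Vertex d n)))

instance instFintypeVertex (d : ℕ) : (n : ℕ) → Fintype (Vertex d n)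
  | 0 => inferInstanceAs (Fintype Unit)
  | n + 1 =>
    haveI := instFintypeVertex d n
    inferInstanceAs (Fintype (Option (Fin d × Vertex d n)))

/-- The root of the `d`-ary tree of height `n`. -/
def root (d : ℕ) : (n : ℕ) → Vertex d n
  | 0 => ()
  | _ + 1 => none

/-- `IsParent d n u v` says that `u` is the parent of `v`: the root is the parent of the roots of
the `d` subtrees, and inside each subtree the relation is that of the subtree. -/
def IsParent (d : ℕ) : (n : ℕ) → Vertex d n → Vertex d n → Prop
  | 0, _, _ => False
  | _ + 1, _, none => False
  | n + 1, none, some (_, v) => v = root d n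
  | n + 1, some (i, u), some (j, v) => i = j ∧ IsParent d n u v

/-- The `d`-ary tree of height `n`: every vertex is joined to its parent. -/
def tree (d n : ℕ) : SimpleGraph (Vertex d n) :=
  SimpleGraph.fromRel (IsParent d n)

/-- The leaves of the tree are the vertices at depth `n`. -/
def IsLeaf (d : ℕ) : (n : ℕ) → Vertex d n → Prop
  | 0, _ => True
  | _ + 1, none => False
  | n + 1, some (_, v) => IsLeaf d n v

/-- The set of leaves of the `d`-ary tree of height `n`. -/
def leaves (d n : ℕ) : Set (Vertex d n) :=
  {v | IsLeaf d n v}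

/-- The probability that the root of the `d`-ary tree of height `n` has colour `c` in the
`q`-state Potts model with parameter `β`, conditioned on the configuration `τ` on the leaves. -/
def rootMarginal {q : ℕ} (d n : ℕ) (β : ℝ) (τ : leaves d n → Fin q) (c : Fin q) : ℝ :=
  Potts.condProb (tree d n) β
    {σ : Vertex d n → Fin q | σ (root d n) = c}
    {σ : Vertex d n → Fin q | ∀ v : leaves d n, σ v = τ v}

end DaryTree

end

/-! ### The recursion on the tree -/

namespace Potts

variable {V : Type*} {q : ℕ}

theorem weight_pos (G : SimpleGraph V) {β : ℝ} (hβ : 0 < β) (σ : V → Fin q) :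
    0 < weight G β σ := pow_pos hβ _

variable [Fintype V] [DecidableEq V]

theorem condProb_eq_div (G : SimpleGraph V) {β : ℝ} (hβ : 0 < β) (hq : 0 < q)
    (A B : Set (V → Fin q)) :
    condProb G β A B = (∑ σ, (A ∩ B).indicator (weight G β) σ) / ∑ σ, B.indicator (weight G β) σ := by
  have hZ : 0 < partitionFunction G q β :=
    Finset.sum_pos (fun σ _ => weight_pos G hβ σ) ⟨fun _ => ⟨0, hq⟩, Finset.mem_univ _⟩
  have key : ∀ C : Set (V → Fin q),
      prob G β C = (∑ σ, C.indicator (weight G β) σ) / partitionFunction G q β := by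
    intro C
    rw [prob, Finset.sum_div]
    refine Finset.sum_congr rfl fun σ _ => ?_
    by_cases h : σ ∈ C <;> simp [h, gibbsMass]
  rw [condProb, key, key, div_div_div_cancel_right₀ hZ.ne']

end Potts

namespace DaryTree

variable {q : ℕ}

/-- The `i`-th subtree configuration of a configuration on the tree of height `n + 1`. -/
def subConfig {d n : ℕ} (σ : Vertex d (n + 1) → Fin q) (i : Fin d) : Vertex d n → Fin q :=
  fun v => σ (some (i, v))

/-- The vertex of the tree of height `n + 1` that corresponds to a vertex of the `i`-th subtree. -/
def child {d n : ℕ} (i : Fin d) (v : Vertex d n) : Vertex d (n + 1) := some (i, v)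

/-- The boundary condition that a boundary condition induces on the `i`-th subtree. -/
def subBoundary {d n : ℕ} (τ : leaves d (n + 1) → Fin q) (i : Fin d) : leaves d n → Fin q :=
  fun v => τ ⟨some (i, v.1), v.2⟩

/-- A configuration is a root colour together with a configuration on each subtree. -/
def configEquiv (q d n : ℕ) :
    (Vertex d (n + 1) → Fin q) ≃ Fin q × (Fin d → Vertex d n → Fin q) where
  toFun σ := (σ none, subConfig σ)
  invFun p := fun v => Option.elim (α := Fin d × Vertex d n) v p.1 (fun w => p.2 w.1 w.2)
  left_inv σ := by
    funext v
    rcases v with _ | ⟨i, v⟩ <;> rfl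
  right_inv p := rfl

theorem isParent_ne {d : ℕ} : ∀ {n : ℕ} {u v : Vertex d n}, IsParent d n u v → u ≠ v
  | 0, _, _, h => h.elim
  | _ + 1, none, none, h => h.elim
  | _ + 1, some _, none, h => h.elim
  | _ + 1, none, some _, _ => fun h => (Option.some_ne_none _ h.symm).elim
  | _ + 1, some (i, u), some (j, v), h => by
    intro he
    have : (i, u) = (j, v) := Option.some.inj he
    exact isParent_ne h.2 (Prod.ext_iff.1 this).2

/-- The pairs of a parent and its child that have the same colour. -/
def monoPairs {d n : ℕ} (σ : Vertex d n → Fin q) : Set (Vertex d n × Vertex d n) :=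
  {p | IsParent d n p.1 p.2 ∧ σ p.1 = σ p.2}

theorem isParent_asymm {d : ℕ} : ∀ {n : ℕ} {u v : Vertex d n},
    IsParent d n u v → ¬ IsParent d n v u
  | 0, _, _, h => h.elim
  | _ + 1, none, none, h => h.elim
  | _ + 1, some _, none, h => h.elim
  | _ + 1, none, some _, _ => fun h => h.elim
  | _ + 1, some (_, _), some (_, _), h => fun h' => isParent_asymm h.2 h'.2

theorem monoEdges_tree {d n : ℕ} (σ : Vertex d n → Fin q) :
    Potts.monoEdges (tree d n) σ = (monoPairs σ).ncard := by
  unfold Potts.monoEdges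
  symm
  refine Set.ncard_congr (fun p _ => s(p.1, p.2)) ?_ ?_ ?_
  · rintro ⟨u, v⟩ ⟨h, h'⟩
    exact ⟨⟨isParent_ne h, Or.inl h⟩, h'⟩
  · rintro ⟨u, v⟩ ⟨u', v'⟩ ⟨h, _⟩ ⟨h', _⟩ he
    rcases Sym2.eq_iff.1 he with ⟨h1, h2⟩ | ⟨h1, h2⟩
    · exact Prod.ext h1 h2
    · subst h1 h2
      exact (isParent_asymm h h').elim
  · intro e
    induction e using Sym2.ind with
    | _ u v =>
      rintro ⟨⟨_, h | h⟩, h'⟩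
      · exact ⟨(u, v), ⟨h, h'⟩, rfl⟩
      · exact ⟨(v, u), ⟨h, Eq.symm h'⟩, Sym2.eq_swap⟩

theorem ncard_monoPairs_succ {d n : ℕ} (σ : Vertex d (n + 1) → Fin q) :
    (monoPairs σ).ncard = ∑ i, ((monoPairs (subConfig σ i)).ncard +
      if subConfig σ i (root d n) = σ none then 1 else 0) := by
  classical
  let f : Fin d → Vertex d n × Vertex d n → Vertex d (n + 1) × Vertex d (n + 1) :=
    fun i p => (child i p.1, child i p.2)
  let g : Fin d → Set (Vertex d (n + 1) × Vertex d (n + 1)) := fun i =>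
    f i '' monoPairs (subConfig σ i) ∪
      if subConfig σ i (root d n) = σ none then {(root d (n + 1), child i (root d n))} else ∅
  have hfinj : ∀ i, Function.Injective (f i) := by
    rintro i ⟨u, v⟩ ⟨u', v'⟩ h
    have h1 : (i, u) = (i, u') := Option.some.inj (Prod.ext_iff.1 h).1
    have h2 : (i, v) = (i, v') := Option.some.inj (Prod.ext_iff.1 h).2
    exact Prod.ext (Prod.ext_iff.1 h1).2 (Prod.ext_iff.1 h2).2
  have hg : ∀ i p, p ∈ g i → ∃ v, p.2 = child i v := by
    rintro i p (⟨w, _, rfl⟩ | h)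
    · exact ⟨_, rfl⟩
    · split_ifs at h
      · rw [Set.mem_singleton_iff] at h
        exact ⟨_, by rw [h]⟩
      · exact h.elim
  have hunion : monoPairs σ = ⋃ i, g i := by
    ext ⟨u, v⟩
    simp only [Set.mem_iUnion]
    constructor
    · rintro ⟨h, h'⟩
      rcases v with _ | ⟨j, v⟩
      · rcases u with _ | u <;> exact h.elim
      · rcases u with _ | ⟨i, u⟩
        · have hv : v = root d n := h
          subst hv
          refine ⟨j, Or.inr ?_⟩
          have : subConfig σ j (root d n) = σ none := h'.symm
          rw [if_pos this]
          rfl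
        · obtain ⟨rfl, h⟩ : i = j ∧ IsParent d n u v := h
          exact ⟨i, Or.inl ⟨(u, v), ⟨h, h'⟩, rfl⟩⟩
    · rintro ⟨i, ⟨⟨u', v'⟩, ⟨h, h'⟩, he⟩ | h⟩
      · rw [← he]
        exact ⟨⟨rfl, h⟩, h'⟩
      · split_ifs at h with hc
        · rw [Set.mem_singleton_iff] at h
          rw [h]
          exact ⟨rfl, hc.symm⟩
        · exact h.elim
  have hdisj : Pairwise fun i j => Disjoint (g i) (g j) := by
    intro i j hij
    rw [Set.disjoint_left]
    intro p hi hj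
    obtain ⟨v, hv⟩ := hg i p hi
    obtain ⟨w, hw⟩ := hg j p hj
    have : (i, v) = (j, w) := Option.some.inj (hv.symm.trans hw)
    exact hij (Prod.ext_iff.1 this).1
  rw [hunion, Set.ncard_iUnion_of_finite (fun _ => Set.toFinite _) hdisj, finsum_eq_sum_of_fintype]
  refine Finset.sum_congr rfl fun i _ => ?_
  rw [Set.ncard_union_eq _ (Set.toFinite _) (Set.toFinite _), Set.ncard_image_of_injective _ (hfinj i)]
  · congr 1
    split_ifs <;> simp
  · rw [Set.disjoint_left]
    rintro p ⟨w, _, rfl⟩ h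
    split_ifs at h
    · have := (Prod.ext_iff.1 (Set.mem_singleton_iff.1 h)).1
      exact Option.some_ne_none _ this
    · exact h

theorem weight_tree_succ {d n : ℕ} (β : ℝ) (σ : Vertex d (n + 1) → Fin q) :
    Potts.weight (tree d (n + 1)) β σ = ∏ i, (Potts.weight (tree d n) β (subConfig σ i) *
      if subConfig σ i (root d n) = σ none then β else 1) := by
  simp only [Potts.weight, monoEdges_tree]
  rw [ncard_monoPairs_succ, ← Finset.prod_pow_eq_pow_sum]
  refine Finset.prod_congr rfl fun i _ => ?_
  rw [pow_add]
  split_ifs <;> simp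

open Classical in
/-- The total weight of the configurations that agree with `τ` on the leaves and give the root the
colour `c`. -/
noncomputable def rootWeight (d n : ℕ) (β : ℝ) (τ : leaves d n → Fin q) (c : Fin q) : ℝ :=
  ∑ σ : Vertex d n → Fin q, if σ (root d n) = c ∧ ∀ v : leaves d n, σ v = τ v then
    Potts.weight (tree d n) β σ else 0

theorem rootWeight_nonneg {d n : ℕ} {β : ℝ} (hβ : 0 < β) (τ : leaves d n → Fin q) (c : Fin q) :
    0 ≤ rootWeight d n β τ c := by
  classical
  refine Finset.sum_nonneg fun σ _ => ?_
  split_ifs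
  · exact (Potts.weight_pos _ hβ σ).le
  · exact le_rfl

open Classical in
theorem sum_rootWeight (d n : ℕ) (β : ℝ) (τ : leaves d n → Fin q) :
    ∑ c, rootWeight d n β τ c = ∑ σ : Vertex d n → Fin q,
      if ∀ v : leaves d n, σ v = τ v then Potts.weight (tree d n) β σ else 0 := by
  unfold rootWeight
  rw [Finset.sum_comm]
  refine Finset.sum_congr rfl fun σ _ => ?_
  simp only [ite_and]
  rw [Finset.sum_ite_eq]
  simp

theorem sum_rootWeight_pos {d n : ℕ} {β : ℝ} (hβ : 0 < β) (hq : 0 < q) (τ : leaves d n → Fin q) :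
    0 < ∑ c, rootWeight d n β τ c := by
  classical
  rw [sum_rootWeight]
  let σ₀ : Vertex d n → Fin q := fun v => if h : v ∈ leaves d n then τ ⟨v, h⟩ else ⟨0, hq⟩
  refine Finset.sum_pos' (fun σ _ => ?_) ⟨σ₀, Finset.mem_univ _, ?_⟩
  · split_ifs
    · exact (Potts.weight_pos _ hβ σ).le
    · exact le_rfl
  · rw [if_pos]
    · exact Potts.weight_pos _ hβ σ₀
    · rintro ⟨v, hv⟩
      simp [σ₀, hv]

theorem rootMarginal_eq_div {d n : ℕ} {β : ℝ} (hβ : 0 < β) (hq : 0 < q) (τ : leaves d n → Fin q)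
    (c : Fin q) :
    rootMarginal d n β τ c = rootWeight d n β τ c / ∑ c', rootWeight d n β τ c' := by
  classical
  rw [rootMarginal, Potts.condProb_eq_div _ hβ hq, sum_rootWeight, rootWeight]
  simp only [Set.indicator_apply, Set.mem_inter_iff, Set.mem_ofPred_eq]

theorem rootMarginal_nonneg {d n : ℕ} {β : ℝ} (hβ : 0 < β) (hq : 0 < q) (τ : leaves d n → Fin q)
    (c : Fin q) : 0 ≤ rootMarginal d n β τ c := by
  rw [rootMarginal_eq_div hβ hq]
  exact div_nonneg (rootWeight_nonneg hβ τ c) (sum_rootWeight_pos hβ hq τ).le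

theorem sum_rootMarginal {d n : ℕ} {β : ℝ} (hβ : 0 < β) (hq : 0 < q) (τ : leaves d n → Fin q) :
    ∑ c, rootMarginal d n β τ c = 1 := by
  simp only [rootMarginal_eq_div hβ hq]
  rw [← Finset.sum_div, div_self (sum_rootWeight_pos hβ hq τ).ne']

theorem forall_leaves_succ {d n : ℕ} (σ : Vertex d (n + 1) → Fin q)
    (τ : leaves d (n + 1) → Fin q) :
    (∀ v : leaves d (n + 1), σ v = τ v) ↔
      ∀ i, ∀ v : leaves d n, subConfig σ i v = subBoundary τ i v := by
  constructor
  · intro h i v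
    exact h ⟨some (i, v.1), v.2⟩
  · rintro h ⟨_ | ⟨i, v⟩, hv⟩
    · exact hv.elim
    · exact h i ⟨v, hv⟩

theorem rootWeight_succ (d n : ℕ) (β : ℝ) (τ : leaves d (n + 1) → Fin q) (c : Fin q) :
    rootWeight d (n + 1) β τ c = ∏ i, (∑ c', rootWeight d n β (subBoundary τ i) c' -
      (1 - β) * rootWeight d n β (subBoundary τ i) c) := by
  classical
  have hfac : ∀ i : Fin d, ∑ c', rootWeight d n β (subBoundary τ i) c' -
      (1 - β) * rootWeight d n β (subBoundary τ i) c =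
      ∑ σ : Vertex d n → Fin q, if ∀ v : leaves d n, σ v = subBoundary τ i v then
        Potts.weight (tree d n) β σ * (if σ (root d n) = c then β else 1) else 0 := by
    intro i
    rw [sum_rootWeight, rootWeight, Finset.mul_sum, ← Finset.sum_sub_distrib]
    refine Finset.sum_congr rfl fun σ _ => ?_
    by_cases h1 : σ (root d n) = c <;> by_cases h2 : ∀ v : leaves d n, σ v = subBoundary τ i v <;>
      simp only [h1, h2, if_true, if_false, and_true, and_false,
        implies_true] <;> ring
  simp only [hfac]
  rw [Finset.prod_univ_sum, Fintype.piFinset_univ, rootWeight,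
    ← (configEquiv q d n).symm.sum_comp, Fintype.sum_prod_type, Finset.sum_eq_single c]
  · refine Finset.sum_congr rfl fun σ _ => ?_
    rw [weight_tree_succ]
    have h1 : ((configEquiv q d n).symm (c, σ)) (root d (n + 1)) = c := rfl
    have h1' : ((configEquiv q d n).symm (c, σ)) none = c := rfl
    have h2 : subConfig ((configEquiv q d n).symm (c, σ)) = σ := rfl
    simp only [forall_leaves_succ, h1, h1', h2, true_and]
    split_ifs with h
    · exact Finset.prod_congr rfl fun i _ => by rw [if_pos (h i)]
    · obtain ⟨i, hi⟩ := not_forall.1 h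
      exact (Finset.prod_eq_zero (Finset.mem_univ i) (if_neg hi)).symm
  · intro c' _ hc
    refine Finset.sum_eq_zero fun σ _ => if_neg fun h => hc h.1
  · simp

theorem rootMarginal_succ {d n : ℕ} {β : ℝ} (hβ : 0 < β) (hq : 0 < q)
    (τ : leaves d (n + 1) → Fin q) (c : Fin q) :
    rootMarginal d (n + 1) β τ c =
      (∏ i, (1 - (1 - β) * rootMarginal d n β (subBoundary τ i) c)) /
        ∑ c', ∏ i, (1 - (1 - β) * rootMarginal d n β (subBoundary τ i) c') := by
  have key : ∀ c', rootWeight d (n + 1) β τ c' =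
      (∏ i, ∑ a, rootWeight d n β (subBoundary τ i) a) *
        ∏ i, (1 - (1 - β) * rootMarginal d n β (subBoundary τ i) c') := by
    intro c'
    rw [rootWeight_succ, ← Finset.prod_mul_distrib]
    refine Finset.prod_congr rfl fun i _ => ?_
    rw [rootMarginal_eq_div hβ hq]
    have := (sum_rootWeight_pos hβ hq (subBoundary τ i)).ne'
    field_simp
  have hW : ∏ i, ∑ a, rootWeight d n β (subBoundary τ i) a ≠ 0 :=
    Finset.prod_ne_zero_iff.2 fun i _ => (sum_rootWeight_pos hβ hq _).ne'
  rw [rootMarginal_eq_div hβ hq]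
  simp only [key]
  rw [← Finset.mul_sum, mul_div_mul_left _ _ hW]

end DaryTree

/-! ### One step of the recursion on a box, and the limiting box -/

theorem pow_add_pow_le_pow_add_pow {x y w M : ℝ} (n : ℕ) (hw : 0 ≤ w) (hwx : w ≤ x) (hxM : x ≤ M)
    (h : x + y = w + M) : x ^ n + y ^ n ≤ w ^ n + M ^ n := by
  have hy : w ≤ y := by linarith
  have hM : y ≤ M := by linarith
  have key : x ^ n - w ^ n ≤ M ^ n - y ^ n := by
    rw [← (Commute.all x w).mul_geom_sum₂ n, ← (Commute.all M y).mul_geom_sum₂ n,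
      show M - y = x - w by linarith]
    refine mul_le_mul_of_nonneg_left (Finset.sum_le_sum fun i _ => ?_) (by linarith)
    exact mul_le_mul (pow_le_pow_left₀ (by linarith) hxM _) (pow_le_pow_left₀ hw hy _)
      (pow_nonneg hw _) (pow_nonneg (by linarith) _)
  linarith

theorem prod_add_prod_le {d : ℕ} (hd : 0 < d) {y z : Fin d → ℝ} {K : ℝ} (hy : ∀ i, 0 ≤ y i)
    (hz : ∀ i, 0 ≤ z i) (h : ∀ i, y i ^ d + z i ^ d ≤ K) : ∏ i, y i + ∏ i, z i ≤ K := by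
  have hd' : (d : ℝ) ≠ 0 := by positivity
  have amgm : ∀ x : Fin d → ℝ, (∀ i, 0 ≤ x i) → ∏ i, x i ≤ ∑ i, (1 / d : ℝ) * x i ^ d := by
    intro x hx
    have := Real.geom_mean_le_arith_mean_weighted Finset.univ (fun _ => (1 / d : ℝ))
      (fun i => x i ^ d) (fun _ _ => by positivity) (by simp [hd']) (fun i _ => pow_nonneg (hx i) _)
    refine le_trans (le_of_eq ?_) this
    refine Finset.prod_congr rfl fun i _ => ?_
    rw [one_div, Real.pow_rpow_inv_natCast (hx i) hd.ne']
  calc ∏ i, y i + ∏ i, z i ≤ ∑ i, (1 / d : ℝ) * y i ^ d + ∑ i, (1 / d : ℝ) * z i ^ d :=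
        add_le_add (amgm y hy) (amgm z hz)
    _ = ∑ i, (1 / d : ℝ) * (y i ^ d + z i ^ d) := by
        rw [← Finset.sum_add_distrib]
        exact Finset.sum_congr rfl fun _ _ => by ring
    _ ≤ ∑ _i : Fin d, (1 / d : ℝ) * K :=
        Finset.sum_le_sum fun i _ => mul_le_mul_of_nonneg_left (h i) (by positivity)
    _ = K := by
        simp
        field_simp

/-- The bound on the largest marginal of the root when the marginals of the children lie in
`[l, u]`. -/
theorem marginal_upper_step {d : ℕ} {b l u : ℝ} (hb0 : 0 < b) (hb1 : b < 1) (hl : 0 ≤ l)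
    (hu : u ≤ 1) (hlu : l ≤ u) {x y z : Fin d → ℝ} (hx : ∀ i, l ≤ x i)
    (hy : ∀ i, y i ≤ u) (hz : ∀ i, z i ≤ u) (hsum : ∀ i, x i + y i + z i = 1)
    (hxu : ∀ i, x i ≤ u) :
    (∏ i, (1 - b * x i)) * ((1 - b * l) ^ d +
      2 * √(((1 - b * u) * (1 - b * (1 - l - u))) ^ d)) ≤
    (1 - b * l) ^ d * (∏ i, (1 - b * x i) + ∏ i, (1 - b * y i) + ∏ i, (1 - b * z i)) := by
  have hpos : ∀ t, t ≤ u → 0 < 1 - b * t := fun t ht => by nlinarith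
  have hY : 0 < 1 - b * l := by nlinarith
  have hX : 0 ≤ (1 - b * u) * (1 - b * (1 - l - u)) := by
    have h1 := hpos u le_rfl
    have h2 : 0 < 1 - b * (1 - l - u) := by
      nlinarith
    positivity
  set A := ∏ i, (1 - b * x i)
  set B := ∏ i, (1 - b * y i)
  set C := ∏ i, (1 - b * z i)
  have hA : 0 < A := Finset.prod_pos fun i _ => hpos _ (hxu i)
  have hB : 0 < B := Finset.prod_pos fun i _ => hpos _ (hy i)
  have hC : 0 < C := Finset.prod_pos fun i _ => hpos _ (hz i)
  have key : A ^ 2 * ((1 - b * u) * (1 - b * (1 - l - u))) ^ d ≤ B * C * ((1 - b * l) ^ d) ^ 2 := by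
    have h : ∏ i, ((1 - b * x i) ^ 2 * ((1 - b * u) * (1 - b * (1 - l - u)))) ≤
        ∏ i, ((1 - b * y i) * (1 - b * z i) * (1 - b * l) ^ 2) := by
      refine Finset.prod_le_prod (fun i _ => by positivity) fun i _ => ?_
      have h1 : (1 - b * u) * (1 - b * (1 - x i - u)) ≤ (1 - b * y i) * (1 - b * z i) := by
        have hz' : z i = 1 - x i - y i := by linarith [hsum i]
        have := mul_nonneg (sub_nonneg.2 (hy i)) (sub_nonneg.2 (hz i))
        have h2 : (1 - b * y i) * (1 - b * z i) - (1 - b * u) * (1 - b * (1 - x i - u)) =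
          b ^ 2 * ((u - y i) * (u - z i)) := by rw [hz']; ring
        nlinarith [sq_nonneg b, mul_nonneg (sq_nonneg b) this]
      have h3 : (1 - b * x i) ^ 2 ≤ (1 - b * l) ^ 2 :=
        pow_le_pow_left₀ (hpos _ (hxu i)).le (by nlinarith [hx i]) 2
      have h4 : 1 - b * (1 - l - u) ≤ 1 - b * (1 - x i - u) := by nlinarith [hx i]
      have h5 : 0 ≤ (1 - b * u) * (1 - b * (1 - x i - u)) :=
        hX.trans (mul_le_mul_of_nonneg_left h4 (hpos u le_rfl).le)
      calc _ ≤ (1 - b * l) ^ 2 * ((1 - b * u) * (1 - b * (1 - x i - u))) :=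
            mul_le_mul h3 (mul_le_mul_of_nonneg_left h4 (hpos u le_rfl).le) hX (sq_nonneg _)
        _ ≤ (1 - b * l) ^ 2 * ((1 - b * y i) * (1 - b * z i)) :=
            mul_le_mul_of_nonneg_left h1 (sq_nonneg _)
        _ = _ := mul_comm _ _
    simp only [Finset.prod_mul_distrib, Finset.prod_pow, Finset.prod_const, Finset.card_univ,
      Fintype.card_fin] at h
    rw [mul_pow]
    exact h
  set Y := (1 - b * l) ^ d
  have hYd : 0 < Y := pow_pos hY d
  set W := ((1 - b * u) * (1 - b * (1 - l - u))) ^ d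
  have hW : 0 ≤ W := pow_nonneg hX d
  have h2 : 2 * (A * √W) ≤ (B + C) * Y := by
    refine abs_le_of_sq_le_sq' ?_ (by positivity) |>.2
    have : (2 * (A * √W)) ^ 2 = 4 * (A ^ 2 * W) := by
      rw [mul_pow, mul_pow, Real.sq_sqrt hW]; ring
    rw [this]
    nlinarith [mul_nonneg (sq_nonneg (B - C)) (sq_nonneg Y)]
  nlinarith

/-- The bound on the smallest marginal of the root when the marginals of the children lie in
`[l, u]`. -/
theorem marginal_lower_step {d : ℕ} (hd : 0 < d) {b l u : ℝ} (hb0 : 0 < b) (hb1 : b < 1)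
    (hl : 0 ≤ l) (hu : u ≤ 1) {x y z : Fin d → ℝ} (hx : ∀ i, l ≤ x i)
    (hy : ∀ i, l ≤ y i) (hz : ∀ i, l ≤ z i) (hsum : ∀ i, x i + y i + z i = 1)
    (hxu : ∀ i, x i ≤ u) (hyu : ∀ i, y i ≤ u) (hzu : ∀ i, z i ≤ u) :
    (1 - b * u) ^ d * (∏ i, (1 - b * x i) + ∏ i, (1 - b * y i) + ∏ i, (1 - b * z i)) ≤
      (∏ i, (1 - b * x i)) * ((1 - b * u) ^ d + (1 - b * l) ^ d + (1 - b * (1 - l - u)) ^ d) := by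
  have hpos : ∀ t, t ≤ u → 0 < 1 - b * t := fun t ht => by nlinarith
  have hU := hpos u le_rfl
  have hA : 0 < ∏ i, (1 - b * x i) := Finset.prod_pos fun i _ => hpos _ (hxu i)
  set K := ((1 - b * l) ^ d + (1 - b * (1 - l - u)) ^ d) / (1 - b * u) ^ d
  have h := prod_add_prod_le hd (y := fun i => (1 - b * y i) / (1 - b * x i))
    (z := fun i => (1 - b * z i) / (1 - b * x i)) (K := K)
    (fun i => (div_pos (hpos _ (hyu i)) (hpos _ (hxu i))).le)
    (fun i => (div_pos (hpos _ (hzu i)) (hpos _ (hxu i))).le) (fun i => ?_)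
  · rw [Finset.prod_div_distrib, Finset.prod_div_distrib, ← add_div,
      div_le_div_iff₀ hA (pow_pos hU d)] at h
    nlinarith
  · have hxi := hpos _ (hxu i)
    have hM : 0 < 1 - b * l := by nlinarith [hx i, hxu i]
    have hw : 0 < 1 - b * (1 - x i - l) := by nlinarith [hx i, hxu i, hl]
    have h1 := pow_add_pow_le_pow_add_pow (x := 1 - b * y i) (y := 1 - b * z i)
      (w := 1 - b * (1 - x i - l)) (M := 1 - b * l) d hw.le
      (by nlinarith [hsum i, hz i]) (by nlinarith [hy i])
      (by have := hsum i; have hz' : z i = 1 - x i - y i := by linarith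
          rw [hz']; ring)
    have h2 : (1 - b * l) / (1 - b * x i) ≤ (1 - b * l) / (1 - b * u) :=
      div_le_div_of_nonneg_left hM.le hU (by nlinarith [hxu i])
    have h3 : (1 - b * (1 - x i - l)) / (1 - b * x i) ≤ (1 - b * (1 - l - u)) / (1 - b * u) :=
      div_le_div₀ (by nlinarith [hxu i, hx i]) (by nlinarith [hxu i]) hU (by nlinarith [hxu i])
    calc ((1 - b * y i) / (1 - b * x i)) ^ d + ((1 - b * z i) / (1 - b * x i)) ^ d
        = ((1 - b * y i) ^ d + (1 - b * z i) ^ d) / (1 - b * x i) ^ d := by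
          rw [div_pow, div_pow, add_div]
      _ ≤ ((1 - b * (1 - x i - l)) ^ d + (1 - b * l) ^ d) / (1 - b * x i) ^ d :=
          div_le_div_of_nonneg_right h1 (pow_pos hxi d).le
      _ = ((1 - b * (1 - x i - l)) / (1 - b * x i)) ^ d + ((1 - b * l) / (1 - b * x i)) ^ d := by
          rw [div_pow, div_pow, add_div]
      _ ≤ ((1 - b * (1 - l - u)) / (1 - b * u)) ^ d + ((1 - b * l) / (1 - b * u)) ^ d :=
          add_le_add (pow_le_pow_left₀ (div_pos hw hxi).le h3 d)
            (pow_le_pow_left₀ (div_pos hM hxi).le h2 d)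
      _ = K := by
          rw [div_pow, div_pow, ← add_div, add_comm]

/-- The properties of a box `[l, u]` of marginals that is not improved by the bounds of one step of
the recursion. -/
structure IsLimitBox (d : ℕ) (b l u : ℝ) : Prop where
  nonneg : 0 ≤ l
  le_one : u ≤ 1
  upper_le : u + 2 * l ≤ 1
  lower_ge : 1 ≤ l + 2 * u
  upper_fixed : u * ((1 - b * l) ^ d + 2 * √(((1 - b * u) * (1 - b * (1 - l - u))) ^ d)) ≤
    (1 - b * l) ^ d
  lower_fixed : (1 - b * u) ^ d ≤
    l * ((1 - b * u) ^ d + (1 - b * l) ^ d + (1 - b * (1 - l - u)) ^ d)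

/-- The marginals at depths at least `n` over all boundary conditions. -/
def tailMarginals (S : ℕ → Set (Fin 3 → ℝ)) (n : ℕ) : Set ℝ :=
  {x | ∃ k, n ≤ k ∧ ∃ p ∈ S k, ∃ c, x = p c}

theorem exists_isLimitBox {d : ℕ} (hd : 0 < d) {b : ℝ} (hb0 : 0 < b) (hb1 : b < 1)
    (S : ℕ → Set (Fin 3 → ℝ)) (hne : ∀ n, (S n).Nonempty) (hS0 : ∀ n, ∀ p ∈ S n, ∀ c, 0 ≤ p c)
    (hS1 : ∀ n, ∀ p ∈ S n, ∑ c, p c = 1)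
    (hrec : ∀ n, ∀ p ∈ S (n + 1), ∃ r : Fin d → Fin 3 → ℝ, (∀ i, r i ∈ S n) ∧
      ∀ c, p c = (∏ i, (1 - b * r i c)) / ∑ c', ∏ i, (1 - b * r i c')) :
    ∃ l u, IsLimitBox d b l u ∧ ∀ ε > 0, ∀ᶠ n in atTop, ∀ p ∈ S n, ∀ c,
      l - ε ≤ p c ∧ p c ≤ u + ε := by
  set T := tailMarginals S with hT
  have hTne : ∀ n, (T n).Nonempty := fun n => by
    obtain ⟨p, hp⟩ := hne n
    exact ⟨p 0, n, le_rfl, p, hp, 0, rfl⟩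
  have hp1 : ∀ n, ∀ p ∈ S n, ∀ c, p c ≤ 1 := fun n p hp c => by
    rw [← hS1 n p hp]
    exact Finset.single_le_sum (fun c _ => hS0 n p hp c) (Finset.mem_univ c)
  have hbelow : ∀ n, BddBelow (T n) := fun n => ⟨0, by
    rintro x ⟨k, _, p, hp, c, rfl⟩
    exact hS0 k p hp c⟩
  have habove : ∀ n, BddAbove (T n) := fun n => ⟨1, by
    rintro x ⟨k, _, p, hp, c, rfl⟩
    exact hp1 k p hp c⟩
  have hsub : ∀ m n, m ≤ n → T n ⊆ T m := by
    rintro m n h x ⟨k, hk, hx⟩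
    exact ⟨k, h.trans hk, hx⟩
  set L : ℕ → ℝ := fun n => sInf (T n)
  set U : ℕ → ℝ := fun n => sSup (T n)
  have hL0 : ∀ n, 0 ≤ L n := fun n => le_csInf (hTne n) (by
    rintro x ⟨k, _, p, hp, c, rfl⟩
    exact hS0 k p hp c)
  have hU1 : ∀ n, U n ≤ 1 := fun n => csSup_le (hTne n) (by
    rintro x ⟨k, _, p, hp, c, rfl⟩
    exact hp1 k p hp c)
  have hLle : ∀ n k, n ≤ k → ∀ p ∈ S k, ∀ c, L n ≤ p c := fun n k hk p hp c =>
    csInf_le (hbelow n) ⟨k, hk, p, hp, c, rfl⟩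
  have hUge : ∀ n k, n ≤ k → ∀ p ∈ S k, ∀ c, p c ≤ U n := fun n k hk p hp c =>
    le_csSup (habove n) ⟨k, hk, p, hp, c, rfl⟩
  have hothers : ∀ c : Fin 3, ∃ c₁ c₂ : Fin 3, ∀ f : Fin 3 → ℝ, ∑ i, f i = f c + f c₁ + f c₂ := by
    intro c
    fin_cases c
    · exact ⟨1, 2, fun f => by rw [Fin.sum_univ_three]; rfl⟩
    · exact ⟨0, 2, fun f => by rw [Fin.sum_univ_three]; simp; ring⟩
    · exact ⟨0, 1, fun f => by rw [Fin.sum_univ_three]; simp; ring⟩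
  have hUL : ∀ n, U n + 2 * L n ≤ 1 := by
    intro n
    have : U n ≤ 1 - 2 * L n := csSup_le (hTne n) (by
      rintro x ⟨k, hk, p, hp, c, rfl⟩
      obtain ⟨c₁, c₂, h⟩ := hothers c
      have := (h p).symm.trans (hS1 k p hp)
      linarith [hLle n k hk p hp c₁, hLle n k hk p hp c₂])
    linarith
  have hLU : ∀ n, 1 ≤ L n + 2 * U n := by
    intro n
    have : 1 - 2 * U n ≤ L n := le_csInf (hTne n) (by
      rintro x ⟨k, hk, p, hp, c, rfl⟩
      obtain ⟨c₁, c₂, h⟩ := hothers c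
      have := (h p).symm.trans (hS1 k p hp)
      linarith [hUge n k hk p hp c₁, hUge n k hk p hp c₂])
    linarith
  have hU0 : ∀ n, 0 ≤ U n := fun n => by linarith [hLU n, hUL n, hL0 n]
  have hYpos : ∀ n, 0 < 1 - b * L n := fun n => by nlinarith [hUL n, hL0 n, hU0 n]
  have hstepU : ∀ n, U (n + 1) * ((1 - b * L n) ^ d +
      2 * √(((1 - b * U n) * (1 - b * (1 - L n - U n))) ^ d)) ≤ (1 - b * L n) ^ d := by
    intro n
    have hD : 0 < (1 - b * L n) ^ d +
      2 * √(((1 - b * U n) * (1 - b * (1 - L n - U n))) ^ d) :=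
      add_pos_of_pos_of_nonneg (pow_pos (hYpos n) d) (by positivity)
    rw [← le_div_iff₀ hD]
    refine csSup_le (hTne _) ?_
    rintro x ⟨k, hk, p, hp, c, rfl⟩
    obtain ⟨j, rfl⟩ : ∃ j, k = j + 1 := ⟨k - 1, by omega⟩
    have hj : n ≤ j := by omega
    obtain ⟨r, hr, hpr⟩ := hrec j p hp
    obtain ⟨c₁, c₂, h⟩ := hothers c
    have hlo := fun i => hLle n j hj (r i) (hr i)
    have hhi := fun i => hUge n j hj (r i) (hr i)
    have hA : ∀ c, 0 < ∏ i, (1 - b * r i c) := fun c =>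
      Finset.prod_pos fun i _ => by nlinarith [hhi i c, hU1 n]
    rw [hpr c, h, le_div_iff₀ hD, div_mul_eq_mul_div, div_le_iff₀ (by linarith [hA c, hA c₁, hA c₂])]
    exact marginal_upper_step hb0 hb1 (hL0 n) (hU1 n) (by linarith [hUL n, hLU n]) (fun i => hlo i c)
      (fun i => hhi i c₁) (fun i => hhi i c₂)
      (fun i => (h (r i)).symm.trans (hS1 j (r i) (hr i))) (fun i => hhi i c)
  have hstepL : ∀ n, (1 - b * U n) ^ d ≤ L (n + 1) *
      ((1 - b * U n) ^ d + (1 - b * L n) ^ d + (1 - b * (1 - L n - U n)) ^ d) := by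
    intro n
    have h1 : 0 < 1 - b * U n := by nlinarith [hU1 n]
    have h2 : 0 < 1 - b * (1 - L n - U n) := by nlinarith [hU0 n, hL0 n]
    have hD : 0 < (1 - b * U n) ^ d + (1 - b * L n) ^ d + (1 - b * (1 - L n - U n)) ^ d := by
      have := hYpos n
      positivity
    rw [← div_le_iff₀ hD]
    refine le_csInf (hTne _) ?_
    rintro x ⟨k, hk, p, hp, c, rfl⟩
    obtain ⟨j, rfl⟩ : ∃ j, k = j + 1 := ⟨k - 1, by omega⟩
    have hj : n ≤ j := by omega
    obtain ⟨r, hr, hpr⟩ := hrec j p hp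
    obtain ⟨c₁, c₂, h⟩ := hothers c
    have hlo := fun i => hLle n j hj (r i) (hr i)
    have hhi := fun i => hUge n j hj (r i) (hr i)
    have hA : ∀ c, 0 < ∏ i, (1 - b * r i c) := fun c =>
      Finset.prod_pos fun i _ => by nlinarith [hhi i c, hU1 n]
    rw [hpr c, h, div_le_div_iff₀ hD (by linarith [hA c, hA c₁, hA c₂])]
    exact marginal_lower_step hd hb0 hb1 (hL0 n) (hU1 n) (fun i => hlo i c)
      (fun i => hlo i c₁) (fun i => hlo i c₂)
      (fun i => (h (r i)).symm.trans (hS1 j (r i) (hr i))) (fun i => hhi i c)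
      (fun i => hhi i c₁) (fun i => hhi i c₂)
  have hLmono : Monotone L := fun m n h => csInf_le_csInf (hbelow m) (hTne n) (hsub m n h)
  have hUanti : Antitone U := fun m n h => csSup_le_csSup (habove m) (hTne n) (hsub m n h)
  have hLb : BddAbove (Set.range L) := ⟨1, by
    rintro _ ⟨n, rfl⟩
    linarith [hUL n, hL0 n, hU0 n]⟩
  have hUb : BddBelow (Set.range U) := ⟨0, by
    rintro _ ⟨n, rfl⟩
    exact hU0 n⟩
  have hLt := tendsto_atTop_ciSup hLmono hLb
  have hUt := tendsto_atTop_ciInf hUanti hUb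
  set l := ⨆ n, L n
  set u := ⨅ n, U n
  have hLt' := hLt.comp (tendsto_add_atTop_nat 1)
  have hUt' := hUt.comp (tendsto_add_atTop_nat 1)
  have hY := (tendsto_const_nhds (x := (1 : ℝ))).sub (hLt.const_mul b)
  have hX := (tendsto_const_nhds (x := (1 : ℝ))).sub (hUt.const_mul b)
  have hM := (tendsto_const_nhds (x := (1 : ℝ))).sub
    (((tendsto_const_nhds (x := (1 : ℝ))).sub hLt |>.sub hUt).const_mul b)
  refine ⟨l, u, ⟨ge_of_tendsto' hLt hL0, le_of_tendsto' hUt hU1,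
    le_of_tendsto' (hUt.add (hLt.const_mul 2)) hUL, ge_of_tendsto' (hLt.add (hUt.const_mul 2)) hLU,
    ?_, ?_⟩, ?_⟩
  · exact le_of_tendsto_of_tendsto' (hUt'.mul ((hY.pow d).add
      (((hX.mul hM).pow d).sqrt.const_mul 2))) (hY.pow d) hstepU
  · exact le_of_tendsto_of_tendsto' (hX.pow d)
      (hLt'.mul (((hX.pow d).add (hY.pow d)).add (hM.pow d))) hstepL
  · intro ε hε
    filter_upwards [hLt.eventually (lt_mem_nhds (sub_lt_self l hε)),
      hUt.eventually (gt_mem_nhds (lt_add_of_pos_right u hε))] with n h1 h2 p hp c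
    exact ⟨h1.le.trans (hLle n n le_rfl p hp c), (hUge n n le_rfl p hp c).trans h2.le⟩

namespace DaryTree

theorem exists_isLimitBox_rootMarginal {d : ℕ} (hd : 0 < d) {β : ℝ} (hβ0 : 0 < β) (hβ1 : β < 1) :
    ∃ l u, IsLimitBox d (1 - β) l u ∧ ∀ ε > 0, ∀ᶠ n in atTop,
      ∀ (τ : leaves d n → Fin 3) (c : Fin 3),
        l - ε ≤ rootMarginal d n β τ c ∧ rootMarginal d n β τ c ≤ u + ε := by
  obtain ⟨l, u, h, hε⟩ := exists_isLimitBox hd (b := 1 - β) (by linarith) (by linarith)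
    (fun n => Set.range fun τ : leaves d n → Fin 3 => rootMarginal d n β τ)
    (fun n => ⟨_, fun _ => 0, rfl⟩)
    (by rintro n _ ⟨τ, rfl⟩ c; exact rootMarginal_nonneg hβ0 (by norm_num) τ c)
    (by rintro n _ ⟨τ, rfl⟩; exact sum_rootMarginal hβ0 (by norm_num) τ)
    (by
      rintro n _ ⟨τ, rfl⟩
      exact ⟨fun i => rootMarginal d n β (subBoundary τ i), fun i => ⟨_, rfl⟩,
        fun c => rootMarginal_succ hβ0 (by norm_num) τ c⟩)
  refine ⟨l, u, h, fun ε hpos => (hε ε hpos).mono fun n hn τ c => hn _ ⟨τ, rfl⟩ c⟩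

end DaryTree

/-! ### The limiting box on the binary tree -/

theorem IsLimitBox.le {d : ℕ} {b l u : ℝ} (h : IsLimitBox d b l u) : l ≤ u := by
  linarith [h.upper_le, h.lower_ge]

theorem IsLimitBox.two_upper {b l u : ℝ} (h : IsLimitBox 2 b l u) (hb0 : 0 < b) (hb1 : b < 1)
    (hlu : l < u) : 2 * u * (u + l) < (1 - l) ^ 2 := by
  obtain ⟨hl, hu, h1, h2, h3, -⟩ := h
  have hl1 : l < 1 := by linarith
  have hY : 0 < 1 - b * l := by nlinarith
  have hU : 0 < 1 - b * u := by nlinarith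
  have hM : 0 < 1 - b * (1 - l - u) := by nlinarith
  rw [Real.sqrt_sq (by positivity)] at h3
  have e1 : (1 - u) * (1 - b * l) < (1 - b * u) * (1 - l) := by
    nlinarith [mul_pos (sub_pos.2 hlu) (sub_pos.2 hb1)]
  have e2 : (u + l) * (1 - b * l) ≤ (1 - b * (1 - l - u)) * (1 - l) := by
    nlinarith [mul_nonneg (by linarith : 0 ≤ 1 - l - u - l) (sub_pos.2 hb1).le]
  have e3 : ((1 - u) * (1 - b * l)) * ((u + l) * (1 - b * l)) <
      ((1 - b * u) * (1 - l)) * ((1 - b * (1 - l - u)) * (1 - l)) :=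
    mul_lt_mul e1 e2 (by nlinarith) (mul_pos hU (by linarith)).le
  have e4 : (1 - b * l) ^ 2 * (u * (1 - l) ^ 2 + 2 * u * ((1 - u) * (u + l))) <
      (1 - b * l) ^ 2 * (1 - l) ^ 2 := by
    have hu0 : 0 < u := by linarith
    nlinarith [mul_lt_mul_of_pos_left e3 hu0, mul_le_mul_of_nonneg_right h3 (sq_nonneg (1 - l))]
  have e5 := lt_of_mul_lt_mul_left e4 (sq_nonneg _)
  have e6 : 0 < (1 - u) * ((1 - l) ^ 2 - 2 * u * (u + l)) := by linarith
  linarith [pos_of_mul_pos_right e6 (sub_nonneg.2 hu)]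

theorem IsLimitBox.two_lower {b l u : ℝ} (h : IsLimitBox 2 b l u) (hb0 : 0 < b) (hb1 : b < 1) :
    (1 - u) ^ 2 ≤ l * ((1 - u) ^ 2 + (1 - l) ^ 2 + (u + l) ^ 2) := by
  have hlu := h.le
  obtain ⟨hl, hu, h1, h2, -, h3⟩ := h
  have hY : 0 < 1 - b * l := by nlinarith
  have hU : 0 < 1 - b * u := by nlinarith
  have hM : 0 < 1 - b * (1 - l - u) := by nlinarith
  have e1 : (1 - b * l) * (1 - u) ≤ (1 - l) * (1 - b * u) := by
    nlinarith [mul_nonneg (sub_nonneg.2 hlu) (sub_pos.2 hb1).le]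
  have e2 : (1 - b * (1 - l - u)) * (1 - u) ≤ (u + l) * (1 - b * u) := by
    nlinarith [mul_nonneg (by linarith : 0 ≤ u - (1 - l - u)) (sub_pos.2 hb1).le]
  have f1 := pow_le_pow_left₀ (mul_nonneg hY.le (sub_nonneg.2 hu)) e1 2
  have f2 := pow_le_pow_left₀ (mul_nonneg hM.le (sub_nonneg.2 hu)) e2 2
  have e3 : (1 - b * u) ^ 2 * (1 - u) ^ 2 ≤
      (1 - b * u) ^ 2 * (l * ((1 - u) ^ 2 + (1 - l) ^ 2 + (u + l) ^ 2)) := by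
    nlinarith [mul_le_mul_of_nonneg_right h3 (sq_nonneg (1 - u)),
      mul_le_mul_of_nonneg_left f1 hl, mul_le_mul_of_nonneg_left f2 hl]
  exact le_of_mul_le_mul_left e3 (by positivity)

/-- If the upper fixed point bound puts `u` below `p` then the lower one excludes `l`. -/
theorem two_bounds_false {l u p : ℝ} (hl : 0 ≤ l) (hl1 : l ≤ 1) (hu : 0 ≤ u)
    (h1 : 2 * u * (u + l) < (1 - l) ^ 2)
    (h2 : (1 - u) ^ 2 ≤ l * ((1 - u) ^ 2 + (1 - l) ^ 2 + (u + l) ^ 2))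
    (hp : 0 ≤ p) (hp1 : p ≤ 1) (hp2 : (1 - l) ^ 2 ≤ 2 * p * (p + l))
    (hp3 : l * ((1 - l) ^ 2 + (p + l) ^ 2) < (1 - p) ^ 2 * (1 - l)) : False := by
  have hup : u < p := by
    by_contra! h
    nlinarith
  have e1 : (1 - p) ^ 2 ≤ (1 - u) ^ 2 := pow_le_pow_left₀ (by linarith) (by linarith) 2
  have e2 : (u + l) ^ 2 ≤ (p + l) ^ 2 := pow_le_pow_left₀ (by linarith) (by linarith) 2
  nlinarith [mul_le_mul_of_nonneg_right e1 (sub_nonneg.2 hl1), mul_le_mul_of_nonneg_left e2 hl]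

theorem IsLimitBox.two_bounds {b l u : ℝ} (h : IsLimitBox 2 b l u) (hb0 : 0 < b) (hb1 : b < 1) :
    459 / 2000 < l ∧ u < 1107 / 2500 := by
  rcases h.le.eq_or_lt with he | hlu
  · have h1 := h.upper_le
    have h2 := h.lower_ge
    constructor <;> linarith
  have h1 := h.two_upper hb0 hb1 hlu
  have h2 := h.two_lower hb0 hb1
  have hl := h.nonneg
  have hu := h.le_one
  have hlow : 459 / 2000 < l := by
    by_contra! hl2
    rcases le_total l (3 / 20) with hl3 | hl3
    · refine two_bounds_false (p := 7081 / 10000 - 1176 / 1000 * l) hl (by linarith) (by linarith)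
        h1 h2 (by linarith) (by linarith) (by nlinarith) ?_
      nlinarith [mul_nonneg hl (sub_nonneg.2 hl3), mul_nonneg hl (mul_nonneg hl (sub_nonneg.2 hl3))]
    · obtain ⟨t, rfl⟩ : ∃ t, l = 459 / 2000 - t := ⟨459 / 2000 - l, by ring⟩
      have ht : 0 ≤ t := by linarith
      have ht2 := pow_nonneg ht 2
      have ht3 := pow_nonneg ht 3
      refine two_bounds_false (p := 44204 / 100000 + 11155 / 10000 * t) hl
        (by linarith) (by linarith) h1 h2 (by linarith) (by linarith) ?_ ?_
      · nlinarith
      · ring_nf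
        linarith
  refine ⟨hlow, ?_⟩
  by_contra! hu2
  nlinarith

/-! ### The limiting box on the `d`-ary tree for `d ≥ 3` -/

/-- A lower bound for `(1 - b * u) * (1 - b * (1 - l - u)) / (1 - b * l) ^ 2` when
`b ≤ 3 / (d + 1)`, in terms of `z = 1 / d`, `s = 1 - 3 * l` and `t = 3 * u - 1`. -/
noncomputable def upperRatio (z s t : ℝ) : ℝ :=
  (1 - t * z) * (1 + (t - s) * z) / (1 + s * z) ^ 2

theorem upperRatio_pos {z s t : ℝ} (hz : 0 < z) (hz3 : z ≤ 1 / 3) (hs : 0 ≤ s) (hs1 : s ≤ 1)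
    (ht : 0 ≤ t) (ht2 : t ≤ 2) : 0 < upperRatio z s t := by
  have h1 : 0 < 1 - t * z := by nlinarith
  have h2 : 0 < 1 + (t - s) * z := by nlinarith
  unfold upperRatio
  positivity

theorem upperRatio_antitone {z s s' t : ℝ} (hz : 0 < z) (hz3 : z ≤ 1 / 3) (hs : 0 ≤ s)
    (hss : s ≤ s') (hs1 : s' ≤ 1) (ht : 0 ≤ t) (ht2 : t ≤ 2) :
    upperRatio z s' t ≤ upperRatio z s t := by
  have h1 : 0 < 1 - t * z := by nlinarith
  have h2 : 0 < 1 + (t - s') * z := by nlinarith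
  have h3 : (t - s') * z ≤ (t - s) * z := mul_le_mul_of_nonneg_right (by linarith) hz.le
  have h4 : s * z ≤ s' * z := mul_le_mul_of_nonneg_right hss hz.le
  have h5 : 0 ≤ s * z := mul_nonneg hs hz.le
  unfold upperRatio
  refine div_le_div₀ ?_ (mul_le_mul_of_nonneg_left (by linarith) h1.le) (by positivity)
    (pow_le_pow_left₀ (by linarith) (by linarith) 2)
  exact mul_nonneg h1.le (by linarith)

theorem IsLimitBox.upper_ratio {d : ℕ} {b l u : ℝ} (h : IsLimitBox d b l u) (hd : 3 ≤ d)
    (hb0 : 0 < b) (hb1 : b < 1) (hb : b * (d + 1) ≤ 3) :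
    3 * u * (1 + 2 * √(upperRatio (1 / d) (1 - 3 * l) (3 * u - 1) ^ d)) ≤ 3 := by
  have hlu := h.le
  obtain ⟨hl, hu, h1, h2, h3, -⟩ := h
  have hd' : (3 : ℝ) ≤ d := by exact_mod_cast hd
  have hd0 : (0 : ℝ) < d := by linarith
  have hY : 0 < 1 - b * l := by nlinarith
  have hU : 0 < 1 - b * u := by nlinarith
  have hM : 0 < 1 - b * (1 - l - u) := by nlinarith
  set X := (1 - b * u) * (1 - b * (1 - l - u))
  have hR : upperRatio (1 / d) (1 - 3 * l) (3 * u - 1) ≤ X / (1 - b * l) ^ 2 := by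
    have e0 : upperRatio (1 / d) (1 - 3 * l) (3 * u - 1) =
        ((d + 1 - 3 * u) / (d + 1 - 3 * l)) * ((3 * u + 3 * l + d - 2) / (d + 1 - 3 * l)) := by
      have : (d : ℝ) + 1 - 3 * l ≠ 0 := by linarith
      have : (d : ℝ) + (1 - 3 * l) ≠ 0 := by linarith
      unfold upperRatio
      field_simp
      ring
    have e1 : X / (1 - b * l) ^ 2 =
        ((1 - b * u) / (1 - b * l)) * ((1 - b * (1 - l - u)) / (1 - b * l)) := by
      rw [div_mul_div_comm, ← sq]
    rw [e0, e1]
    have hden : 0 < (d : ℝ) + 1 - 3 * l := by linarith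
    refine mul_le_mul ?_ ?_ (div_nonneg (by linarith) hden.le) (div_pos hU hY).le
    · rw [div_le_div_iff₀ hden hY]
      nlinarith [mul_nonneg (sub_nonneg.2 hlu) (sub_nonneg.2 hb)]
    · rw [div_le_div_iff₀ hden hY]
      nlinarith [mul_nonneg (by linarith : 0 ≤ 1 - l - u - l) (sub_nonneg.2 hb)]
  have hR0 : 0 ≤ upperRatio (1 / d) (1 - 3 * l) (3 * u - 1) := by
    refine (upperRatio_pos (by positivity) ?_ (by linarith) (by linarith) (by linarith)
      (by linarith)).le
    exact one_div_le_one_div_of_le (by norm_num) hd'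
  have hs : √(upperRatio (1 / d) (1 - 3 * l) (3 * u - 1) ^ d) ≤ √(X ^ d) / (1 - b * l) ^ d := by
    calc _ ≤ √((X / (1 - b * l) ^ 2) ^ d) := Real.sqrt_le_sqrt (pow_le_pow_left₀ hR0 hR d)
      _ = _ := by
        rw [div_pow, Real.sqrt_div' _ (by positivity), ← pow_mul, mul_comm 2 d, pow_mul,
          Real.sqrt_sq (by positivity)]
  have hYd : 0 < (1 - b * l) ^ d := pow_pos hY d
  have h4 : u * (1 + 2 * (√(X ^ d) / (1 - b * l) ^ d)) ≤ 1 := by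
    have : u * (1 + 2 * (√(X ^ d) / (1 - b * l) ^ d)) =
      u * ((1 - b * l) ^ d + 2 * √(X ^ d)) / (1 - b * l) ^ d := by field_simp
    rw [this, div_le_one hYd]
    exact h3
  nlinarith

theorem IsLimitBox.lower_ratio {d : ℕ} {b l u : ℝ} (h : IsLimitBox d b l u) (hd : 3 ≤ d)
    (hb0 : 0 < b) (hb1 : b < 1) (hb : b * (d + 1) ≤ 3) :
    3 ≤ 3 * l * (1 + ((1 + (1 - 3 * l) / d) / (1 - (3 * u - 1) / d)) ^ d +
      ((1 + (3 * u + 3 * l - 2) / d) / (1 - (3 * u - 1) / d)) ^ d) := by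
  have hlu := h.le
  obtain ⟨hl, hu, h1, h2, -, h3⟩ := h
  have hd' : (3 : ℝ) ≤ d := by exact_mod_cast hd
  have hd0 : (0 : ℝ) < d := by linarith
  have hY : 0 < 1 - b * l := by nlinarith
  have hU : 0 < 1 - b * u := by nlinarith
  have hM : 0 < 1 - b * (1 - l - u) := by nlinarith
  have hden : 0 < (d : ℝ) + 1 - 3 * u := by linarith
  have hden' : (d : ℝ) - (3 * u - 1) ≠ 0 := by linarith
  have e1 : (1 - b * l) / (1 - b * u) ≤ (1 + (1 - 3 * l) / d) / (1 - (3 * u - 1) / d) := by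
    have : (1 + (1 - 3 * l) / d) / (1 - (3 * u - 1) / d) =
        (d + 1 - 3 * l) / (d + 1 - 3 * u) := by
      have := hden.ne'
      field_simp
      ring
    rw [this, div_le_div_iff₀ hU hden]
    nlinarith [mul_nonneg (sub_nonneg.2 hlu) (sub_nonneg.2 hb)]
  have e2 : (1 - b * (1 - l - u)) / (1 - b * u) ≤
      (1 + (3 * u + 3 * l - 2) / d) / (1 - (3 * u - 1) / d) := by
    have : (1 + (3 * u + 3 * l - 2) / d) / (1 - (3 * u - 1) / d) =
        (d + 3 * u + 3 * l - 2) / (d + 1 - 3 * u) := by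
      have := hden.ne'
      field_simp
      ring
    rw [this, div_le_div_iff₀ hU hden]
    nlinarith [mul_nonneg (by linarith : 0 ≤ u - (1 - l - u)) (sub_nonneg.2 hb)]
  have f1 := pow_le_pow_left₀ (div_pos hY hU).le e1 d
  have f2 := pow_le_pow_left₀ (div_pos hM hU).le e2 d
  have h4 : 1 ≤ l * (1 + ((1 - b * l) / (1 - b * u)) ^ d +
      ((1 - b * (1 - l - u)) / (1 - b * u)) ^ d) := by
    have hUd := pow_pos hU d
    have : l * (1 + ((1 - b * l) / (1 - b * u)) ^ d +
        ((1 - b * (1 - l - u)) / (1 - b * u)) ^ d) =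
      l * ((1 - b * u) ^ d + (1 - b * l) ^ d + (1 - b * (1 - l - u)) ^ d) / (1 - b * u) ^ d := by
      rw [div_pow, div_pow]
      field_simp
    rw [this, one_le_div hUd]
    exact h3
  nlinarith [mul_le_mul_of_nonneg_left f1 hl, mul_le_mul_of_nonneg_left f2 hl]

/-- For `0 ≤ x ≤ y` the power `((1 + x / d) / (1 - y / d)) ^ d` decreases in `d`. -/
theorem div_pow_antitone {d₀ d : ℕ} (hd : d₀ ≤ d) {x y : ℝ} (hx : 0 ≤ x) (hxy : x ≤ y)
    (hy : y < d₀) :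
    ((1 + x / d) / (1 - y / d)) ^ d ≤ ((1 + x / d₀) / (1 - y / d₀)) ^ d₀ := by
  have hd0 : (0 : ℝ) < d₀ := by linarith
  have hdd : (d₀ : ℝ) ≤ d := by exact_mod_cast hd
  have hdpos : (0 : ℝ) < d := by linarith
  set θ : ℝ := d₀ / d with hθ
  have hθ0 : 0 < θ := by positivity
  have hθ1 : θ ≤ 1 := (div_le_one hdpos).2 hdd
  set w : ℝ := 1 / d₀ with hw
  have hw0 : 0 < w := by positivity
  have hyw : y * w < 1 := by
    rw [hw, mul_one_div, div_lt_one hd0]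
    exact hy
  set f : ℝ → ℝ := fun r => θ * (Real.log (1 + x * r) - Real.log (1 - y * r)) -
    (Real.log (1 + x * (θ * r)) - Real.log (1 - y * (θ * r))) with hf
  have hpos : ∀ r ∈ Set.Icc 0 w, 0 < 1 + x * r ∧ 0 < 1 - y * r := by
    rintro r ⟨h0, h1⟩
    have hy0 : 0 ≤ y := hx.trans hxy
    exact ⟨by positivity, by nlinarith⟩
  have hmem : ∀ r ∈ Set.Icc 0 w, θ * r ∈ Set.Icc 0 w := by
    rintro r ⟨h0, h1⟩
    exact ⟨by positivity, by nlinarith⟩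
  have hder : ∀ r ∈ Set.Icc 0 w, HasDerivAt f (θ * (x / (1 + x * r) - -y / (1 - y * r)) -
      (x * θ / (1 + x * (θ * r)) - -(y * θ) / (1 - y * (θ * r)))) r := by
    intro r hr
    obtain ⟨p1, p2⟩ := hpos r hr
    obtain ⟨p3, p4⟩ := hpos _ (hmem r hr)
    have lin : ∀ k : ℝ, HasDerivAt (fun r : ℝ => k * r) k r := fun k => by
      simpa using (hasDerivAt_id r).const_mul k
    have lin2 : ∀ k : ℝ, HasDerivAt (fun r : ℝ => k * (θ * r)) (k * θ) r := fun k =>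
      (lin θ).const_mul k
    exact (((((lin x).const_add 1).log p1.ne').sub (((lin y).const_sub 1).log p2.ne')).const_mul
      θ).sub ((((lin2 x).const_add 1).log p3.ne').sub (((lin2 y).const_sub 1).log p4.ne'))
  have hmono : MonotoneOn f (Set.Icc 0 w) := by
    refine monotoneOn_of_deriv_nonneg (convex_Icc 0 w)
      (fun r hr => (hder r hr).continuousAt.continuousWithinAt)
      (fun r hr => (hder r (interior_subset hr)).differentiableAt.differentiableWithinAt) ?_
    intro r hr
    have hr' := interior_subset hr
    rw [(hder r hr').deriv]
    obtain ⟨p1, p2⟩ := hpos r hr'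
    obtain ⟨p3, p4⟩ := hpos _ (hmem r hr')
    have e : θ * (x / (1 + x * r) - -y / (1 - y * r)) -
        (x * θ / (1 + x * (θ * r)) - -(y * θ) / (1 - y * (θ * r))) =
        θ * (x + y) * (1 / ((1 + x * r) * (1 - y * r)) -
          1 / ((1 + x * (θ * r)) * (1 - y * (θ * r)))) := by
      have g : ∀ v : ℝ, 0 < 1 + x * v → 0 < 1 - y * v → x / (1 + x * v) - -y / (1 - y * v) =
          (x + y) * (1 / ((1 + x * v) * (1 - y * v))) := by
        intro v h1 h2
        rw [div_sub_div _ _ h1.ne' h2.ne', mul_one_div]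
        congr 1
        ring
      linear_combination θ * g r p1 p2 - θ * g (θ * r) p3 p4
    rw [e]
    have hle : (1 + x * r) * (1 - y * r) ≤ (1 + x * (θ * r)) * (1 - y * (θ * r)) := by
      have h0 : 0 ≤ r := hr'.1
      have h1 : θ * r ≤ r := by nlinarith
      have h2 : 0 ≤ θ * r := by positivity
      have h3 : (θ * r) ^ 2 ≤ r ^ 2 := pow_le_pow_left₀ h2 h1 2
      nlinarith [mul_nonneg (sub_nonneg.2 hxy) (sub_nonneg.2 h1),
        mul_nonneg (mul_nonneg hx (hx.trans hxy)) (sub_nonneg.2 h3)]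
    exact mul_nonneg (mul_nonneg hθ0.le (by linarith))
      (sub_nonneg.2 (one_div_le_one_div_of_le (mul_pos p1 p2) hle))
  have h0w := hmono (Set.left_mem_Icc.2 hw0.le) (Set.right_mem_Icc.2 hw0.le) hw0.le
  have hθw : θ * w = 1 / d := by
    rw [hθ, hw]
    field_simp
  obtain ⟨p1, p2⟩ := hpos w (Set.right_mem_Icc.2 hw0.le)
  obtain ⟨p3, p4⟩ := hpos _ (hmem w (Set.right_mem_Icc.2 hw0.le))
  simp only [hf, mul_zero, add_zero, sub_zero, Real.log_one, sub_self] at h0w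
  rw [hθw] at h0w p3 p4
  simp only [hw, mul_one_div] at h0w p1 p2 p3 p4
  rw [← Real.log_le_log_iff (pow_pos (div_pos p3 p4) _) (pow_pos (div_pos p1 p2) _), Real.log_pow,
    Real.log_pow, Real.log_div p3.ne' p4.ne', Real.log_div p1.ne' p2.ne']
  have h1 := mul_le_mul_of_nonneg_left (sub_nonneg.1 h0w) hdpos.le
  rw [← mul_assoc, show (d : ℝ) * θ = d₀ by rw [hθ]; field_simp] at h1
  exact h1

/-- The bound on the smallest marginal, at the arity `d₀` and with a larger value of the largest
marginal. -/
theorem IsLimitBox.lower_ratio_of_le {d₀ d : ℕ} {b l u t : ℝ} (h : IsLimitBox d b l u)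
    (hd₀ : 3 ≤ d₀) (hd : d₀ ≤ d) (hb0 : 0 < b) (hb1 : b < 1) (hb : b * (d + 1) ≤ 3)
    (ht1 : 1 - 3 * l ≤ t) (ht2 : 3 * u - 1 ≤ t) (ht3 : t ≤ 2) :
    3 * (1 - t / d₀) ^ d₀ ≤ 3 * l * ((1 - t / d₀) ^ d₀ + (1 + (1 - 3 * l) / d₀) ^ d₀ +
      (1 + (t - (1 - 3 * l)) / d₀) ^ d₀) := by
  have h0 := h.lower_ratio (hd₀.trans hd) hb0 hb1 hb
  obtain ⟨hl, hu, h1, h2, -, -⟩ := h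
  have hd' : (3 : ℝ) ≤ d₀ := by exact_mod_cast hd₀
  have hdd : (d₀ : ℝ) ≤ d := by exact_mod_cast hd
  have hdpos : (0 : ℝ) < d := by linarith
  have hd0 : (0 : ℝ) < d₀ := by linarith
  have q1 : 0 < 1 - t / d := sub_pos.2 ((div_lt_one hdpos).2 (by linarith))
  have q2 : 1 - t / d ≤ 1 - (3 * u - 1) / d := by
    have := div_le_div_of_nonneg_right ht2 hdpos.le
    linarith
  have q3 : 0 ≤ 1 + (1 - 3 * l) / d := by
    have : 0 ≤ (1 - 3 * l) / d := div_nonneg (by linarith) hdpos.le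
    linarith
  have q4 : 0 ≤ 1 + (3 * u + 3 * l - 2) / d := by
    have : -1 ≤ (3 * u + 3 * l - 2) / d := by
      rw [le_div_iff₀ hdpos]
      linarith
    linarith
  have q5 : 1 + (3 * u + 3 * l - 2) / d ≤ 1 + (t - (1 - 3 * l)) / d := by
    have := div_le_div_of_nonneg_right (by linarith : 3 * u + 3 * l - 2 ≤ t - (1 - 3 * l)) hdpos.le
    linarith
  have f1 := (pow_le_pow_left₀ (div_nonneg q3 (q1.trans_le q2).le)
    (div_le_div_of_nonneg_left q3 q1 q2) d).trans
    (div_pow_antitone hd (by linarith : 0 ≤ 1 - 3 * l) ht1 (by linarith))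
  have f2 := (pow_le_pow_left₀ (div_nonneg q4 (q1.trans_le q2).le)
    (div_le_div₀ (q4.trans q5) q5 q1 q2) d).trans
    (div_pow_antitone hd (by linarith : 0 ≤ t - (1 - 3 * l)) (by linarith : _ ≤ t) (by linarith))
  have q6 : 0 < 1 - t / d₀ := sub_pos.2 ((div_lt_one hd0).2 (by linarith))
  have q7 := pow_pos q6 d₀
  have hsum : ∀ a c : ℝ, 3 * l * ((1 - t / d₀) ^ d₀ + a ^ d₀ + c ^ d₀) / (1 - t / d₀) ^ d₀ =
      3 * l * (1 + (a / (1 - t / d₀)) ^ d₀ + (c / (1 - t / d₀)) ^ d₀) := by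
    intro a c
    rw [mul_div_assoc, add_div, add_div, div_self q7.ne', div_pow, div_pow]
  rw [← le_div_iff₀ q7, hsum]
  exact h0.trans (mul_le_mul_of_nonneg_left (by linarith) (by linarith))

/-- The bound on the largest marginal persists when that marginal is decreased. -/
theorem upper_ratio_of_le {d : ℕ} (hd : 3 ≤ d) {s c t : ℝ} (hs : 0 ≤ s)
    (hsc : s ≤ c) (hct : c ≤ t) (ht : t < 2)
    (h : (1 + t) * (1 + 2 * √(upperRatio (1 / d) s t ^ d)) ≤ 3) :
    (1 + c) * (1 + 2 * √(upperRatio (1 / d) s c ^ d)) ≤ 3 := by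
  have hd' : (3 : ℝ) ≤ d := by exact_mod_cast hd
  have hd0 : (0 : ℝ) < d := by linarith
  set z : ℝ := 1 / d with hz
  have hz0 : 0 < z := by positivity
  have hz3 : z ≤ 1 / 3 := one_div_le_one_div_of_le (by norm_num) hd'
  have hdz : d * z = 1 := by rw [hz]; field_simp
  have a1 : 0 < 1 - c * z := by nlinarith
  have a2 : 0 < 1 + (c - s) * z := by nlinarith
  have a3 : 0 < 1 - t * z := by nlinarith
  have a4 : 0 < 1 + (t - s) * z := by nlinarith
  have a5 : 0 < 1 + s * z := by positivity
  set D := (1 - c * z) * (1 + (c - s) * z) with hD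
  have hDpos : 0 < D := mul_pos a1 a2
  set δ := (t - c) * (t + c - s) * z ^ 2 / D with hδ
  have hδ1 : D * (1 - δ) = (1 - t * z) * (1 + (t - s) * z) := by
    rw [hδ, mul_sub, mul_div_cancel₀ _ hDpos.ne', hD]
    ring
  have hδle : 0 < 1 - δ := by
    have : 0 < D * (1 - δ) := by rw [hδ1]; exact mul_pos a3 a4
    exact pos_of_mul_pos_right this hDpos.le
  have hR : upperRatio z s t = upperRatio z s c * (1 - δ) := by
    unfold upperRatio
    rw [div_mul_eq_mul_div, ← hδ1]
  have hRc : 0 < upperRatio z s c := by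
    unfold upperRatio
    positivity
  have hroot : √((1 - δ) ^ d) = (1 - δ) ^ ((d : ℝ) / 2) := by
    rw [Real.sqrt_eq_rpow, ← Real.rpow_natCast, ← Real.rpow_mul hδle.le]
    congr 1
    ring
  have hbern : 1 - d / 2 * δ ≤ √((1 - δ) ^ d) := by
    rw [hroot]
    have := one_add_mul_self_le_rpow_one_add (s := -δ) (by linarith) (p := (d : ℝ) / 2)
      (by linarith)
    calc 1 - d / 2 * δ = 1 + d / 2 * -δ := by ring
      _ ≤ _ := this
      _ = _ := by rw [← sub_eq_add_neg]
  have hε : (1 + c) * (2 - t) ≤ (1 + t) * (2 - c) * (1 - d / 2 * δ) := by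
    have e1 : d / 2 * δ = (t - c) * ((t + c - s) * z / (2 * D)) := by
      rw [hδ]
      have : (d : ℝ) / 2 * ((t - c) * (t + c - s) * z ^ 2 / D) =
        (d * z) * ((t - c) * ((t + c - s) * z / (2 * D))) := by
        field_simp
      rw [this, hdz, one_mul]
    have e2 : (1 + t) * (2 - c) * ((t + c - s) * z / (2 * D)) ≤ 3 := by
      rw [← mul_div_assoc, div_le_iff₀ (by positivity)]
      have b1 : (t + c - s) * z ≤ 1 + (c - s) * z := by nlinarith
      have b2 : (1 + t) * (2 - c) ≤ 6 * (1 - c * z) := by nlinarith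
      have b3 : 0 ≤ (t + c - s) * z := mul_nonneg (by linarith) hz0.le
      calc (1 + t) * (2 - c) * ((t + c - s) * z) ≤ 6 * (1 - c * z) * (1 + (c - s) * z) :=
            mul_le_mul b2 b1 b3 (by positivity)
        _ = _ := by rw [hD]; ring
    rw [e1]
    nlinarith [mul_le_mul_of_nonneg_left e2 (sub_nonneg.2 hct)]
  set Q := √(upperRatio z s c ^ d)
  have hQ : 0 ≤ Q := Real.sqrt_nonneg _
  have hsplit : √(upperRatio z s t ^ d) = Q * √((1 - δ) ^ d) := by
    rw [hR, mul_pow, Real.sqrt_mul (by positivity)]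
  rw [hsplit] at h
  have h1 : 2 * ((1 + t) * (1 - d / 2 * δ)) * Q ≤ 2 - t := by
    have : (1 + t) * Q * (1 - d / 2 * δ) ≤ (1 + t) * Q * √((1 - δ) ^ d) :=
      mul_le_mul_of_nonneg_left hbern (mul_nonneg (by linarith) hQ)
    linarith
  have h2 : (2 - t) * (2 * (1 + c) * Q) ≤ (2 - t) * (2 - c) := by
    have := mul_le_mul_of_nonneg_right hε hQ
    have := mul_le_mul_of_nonneg_right h1 (by linarith : 0 ≤ 2 - c)
    nlinarith
  have h3 := le_of_mul_le_mul_left h2 (by linarith)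
  linarith

theorem one_add_sq_le_exp_mul {x : ℝ} (hx : 0 ≤ x) (hx4 : x ≤ 1 / 4) :
    (1 + x) ^ 2 ≤ Real.exp (3 * x) * (1 - x - 7 / 50 * x ^ 2) := by
  have h := Real.sum_le_exp_of_nonneg (by positivity : 0 ≤ 3 * x) 5
  simp only [Finset.sum_range_succ, Finset.sum_range_zero, Nat.factorial] at h
  have h1 : 0 ≤ 1 - x - 7 / 50 * x ^ 2 := by nlinarith
  refine le_trans ?_ (mul_le_mul_of_nonneg_right h h1)
  have h2 : 0 ≤ x ^ 2 * (36 / 100 - 42 / 100 * x - 1755 / 1000 * x ^ 2 - 4005 / 1000 * x ^ 3 -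
      4725 / 10000 * x ^ 4) := by
    have := pow_le_pow_left₀ hx hx4 2
    have := pow_le_pow_left₀ hx hx4 3
    have := pow_le_pow_left₀ hx hx4 4
    exact mul_nonneg (sq_nonneg x) (by linarith)
  push_cast
  linarith

theorem exp_neg_le_sqrt_upperRatio_pow {d : ℕ} (hd : 4 ≤ d) {s c : ℝ} (hs : 0 ≤ s) (hs1 : s ≤ 1)
    (hc : c * (c - s) ≤ 7 / 50 * s ^ 2) :
    Real.exp (-(3 / 2 * s)) ≤ √(upperRatio (1 / d) s c ^ d) := by
  have hd' : (4 : ℝ) ≤ d := by exact_mod_cast hd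
  have hd0 : (0 : ℝ) < d := by linarith
  set z : ℝ := 1 / d with hz
  have hz0 : 0 < z := by positivity
  have hz4 : z ≤ 1 / 4 := one_div_le_one_div_of_le (by norm_num) hd'
  have hdz : d * z = 1 := by rw [hz]; field_simp
  have h1 := one_add_sq_le_exp_mul (x := s * z) (by positivity) (by nlinarith)
  have h2 : Real.exp (-(3 * (s * z))) ≤ upperRatio z s c := by
    unfold upperRatio
    rw [le_div_iff₀ (by positivity), Real.exp_neg, inv_mul_le_iff₀ (Real.exp_pos _)]
    refine h1.trans (mul_le_mul_of_nonneg_left ?_ (Real.exp_pos _).le)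
    nlinarith [mul_le_mul_of_nonneg_right hc (sq_nonneg z)]
  refine Real.le_sqrt_of_sq_le ?_
  calc Real.exp (-(3 / 2 * s)) ^ 2 = Real.exp (-(3 * (s * z))) ^ d := by
        rw [← Real.exp_nat_mul, ← Real.exp_nat_mul]
        congr 1
        push_cast
        linear_combination (3 * s) * hdz
    _ ≤ _ := pow_le_pow_left₀ (Real.exp_pos _).le h2 d

theorem exp_mul_lt_line {r : ℝ} (hr : 0 ≤ r) (hr1 : r ≤ 683 / 1000) :
    Real.exp (3 / 2 * (317 / 1000 + r)) * (2 - (677 / 2000 + 57 / 50 * r)) <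
      2 * (1 + (677 / 2000 + 57 / 50 * r)) := by
  set f : ℝ → ℝ := fun r => Real.log (2677 / 2000 + 57 / 50 * r) -
    Real.log (3323 / 2000 - 57 / 50 * r) - 3 / 2 * r with hf
  have hder : ∀ r ∈ Set.Icc (0 : ℝ) (683 / 1000), HasDerivAt f
      (57 / 50 / (2677 / 2000 + 57 / 50 * r) - -(57 / 50) / (3323 / 2000 - 57 / 50 * r) - 3 / 2)
      r := by
    rintro r ⟨h0, h1⟩
    have lin : ∀ k : ℝ, HasDerivAt (fun r : ℝ => k * r) k r := fun k => by
      simpa using (hasDerivAt_id r).const_mul k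
    exact ((((lin _).const_add _).log (by linarith)).sub
      (((lin _).const_sub _).log (by linarith))).sub (lin _)
  have hmono : MonotoneOn f (Set.Icc 0 (683 / 1000)) := by
    refine monotoneOn_of_deriv_nonneg (convex_Icc _ _)
      (fun r hr => (hder r hr).continuousAt.continuousWithinAt)
      (fun r hr => (hder r (interior_subset hr)).differentiableAt.differentiableWithinAt) ?_
    intro r hr
    have hr' := interior_subset hr
    rw [(hder r hr').deriv]
    obtain ⟨h0, h1⟩ := hr'
    have p1 : 0 < 2677 / 2000 + 57 / 50 * r := by linarith
    have p2 : 0 < 3323 / 2000 - 57 / 50 * r := by linarith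
    have : 57 / 50 / (2677 / 2000 + 57 / 50 * r) - -(57 / 50) / (3323 / 2000 - 57 / 50 * r) =
        171 / 50 / ((2677 / 2000 + 57 / 50 * r) * (3323 / 2000 - 57 / 50 * r)) := by
      rw [div_sub_div _ _ p1.ne' p2.ne']
      congr 1
      ring
    rw [this, sub_nonneg, le_div_iff₀ (mul_pos p1 p2)]
    nlinarith [sq_nonneg ((2677 / 2000 + 57 / 50 * r) - (3323 / 2000 - 57 / 50 * r))]
  have h0 := hmono (Set.left_mem_Icc.2 (by norm_num)) ⟨hr, hr1⟩ hr
  have hbase : Real.exp (951 / 2000) < 2 * (2677 / 2000) / (3323 / 2000) := by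
    have := Real.exp_bound' (x := 951 / 2000) (by norm_num) (by norm_num) (n := 5) (by norm_num)
    refine this.trans_lt ?_
    norm_num [Finset.sum_range_succ, Nat.factorial]
  have hlog : 951 / 2000 < Real.log 2 + Real.log (2677 / 2000) - Real.log (3323 / 2000) := by
    rw [← Real.log_mul (by norm_num) (by norm_num), ← Real.log_div (by norm_num) (by norm_num),
      Real.lt_log_iff_exp_lt (by norm_num)]
    exact hbase
  simp only [hf, mul_zero, add_zero, sub_zero] at h0
  have p1 : 0 < 2677 / 2000 + 57 / 50 * r := by linarith
  have p2 : 0 < 3323 / 2000 - 57 / 50 * r := by linarith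
  have h2 : 3 / 2 * (317 / 1000 + r) <
      Real.log (2 * (2677 / 2000 + 57 / 50 * r) / (3323 / 2000 - 57 / 50 * r)) := by
    rw [Real.log_div (by positivity) p2.ne', Real.log_mul (by norm_num) p1.ne']
    linarith
  rw [Real.lt_log_iff_exp_lt (by positivity), lt_div_iff₀ p2] at h2
  calc _ = Real.exp (3 / 2 * (317 / 1000 + r)) * (3323 / 2000 - 57 / 50 * r) := by ring
    _ < _ := h2
    _ = _ := by ring

theorem upper_ratio_line_of_four_le {d : ℕ} (hd : 4 ≤ d) {r : ℝ} (hr : 0 ≤ r)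
    (hr1 : r ≤ 683 / 1000) :
    3 < (1 + (677 / 2000 + 57 / 50 * r)) * (1 + 2 *
      √(upperRatio (1 / d) (317 / 1000 + r) (677 / 2000 + 57 / 50 * r) ^ d)) := by
  have h1 := exp_neg_le_sqrt_upperRatio_pow hd (s := 317 / 1000 + r)
    (c := 677 / 2000 + 57 / 50 * r) (by linarith) (by linarith) (by nlinarith)
  have h2 := exp_mul_lt_line hr hr1
  rw [Real.exp_neg] at h1
  have hE := Real.exp_pos (3 / 2 * (317 / 1000 + r))
  have h3 : 2 - (677 / 2000 + 57 / 50 * r) < 2 * (1 + (677 / 2000 + 57 / 50 * r)) *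
      (Real.exp (3 / 2 * (317 / 1000 + r)))⁻¹ := by
    rw [← div_eq_mul_inv, lt_div_iff₀ hE]
    linarith
  nlinarith [mul_le_mul_of_nonneg_left h1 (by linarith : 0 ≤ 1 + (677 / 2000 + 57 / 50 * r))]

theorem upper_ratio_line_three {r : ℝ} (hr : 0 ≤ r) (hr1 : r ≤ 683 / 1000) :
    3 < (1 + (67 / 200 + 57 / 50 * r)) * (1 + 2 *
      √(upperRatio (1 / (3 : ℕ)) (317 / 1000 + r) (67 / 200 + 57 / 50 * r) ^ 3)) := by
  set Q := √(upperRatio (1 / (3 : ℕ)) (317 / 1000 + r) (67 / 200 + 57 / 50 * r) ^ 3)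
  have hQ0 : 0 ≤ Q := Real.sqrt_nonneg _
  have hRpos := upperRatio_pos (z := 1 / (3 : ℕ)) (s := 317 / 1000 + r)
    (t := 67 / 200 + 57 / 50 * r) (by norm_num) (by norm_num) (by linarith) (by linarith)
    (by linarith) (by linarith)
  have hQ : Q ^ 2 = ((533 / 200 - 57 / 50 * r) * (3018 / 1000 + 7 / 50 * r)) ^ 3 /
      (3317 / 1000 + r) ^ 6 := by
    rw [Real.sq_sqrt (pow_nonneg hRpos.le 3)]
    unfold upperRatio
    have : (3317 / 1000 + r) ≠ 0 := by linarith
    have : 1 + (317 / 1000 + r) * (1 / 3) ≠ 0 := by linarith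
    rw [div_pow, ← pow_mul]
    push_cast
    rw [div_eq_div_iff (by positivity) (by positivity)]
    ring
  by_contra! h
  have h1 : 2 * (267 / 200 + 57 / 50 * r) * Q ≤ 333 / 200 - 57 / 50 * r := by linarith
  have h2 := pow_le_pow_left₀ (by positivity) h1 2
  rw [mul_pow, hQ, ← mul_div_assoc, div_le_iff₀ (by positivity)] at h2
  have g1 : 0 ≤ r * (468 - 765 * r + 993 * r ^ 2) :=
    mul_nonneg hr (by nlinarith [sq_nonneg (r - 765 / 1986)])
  have g2 : 0 ≤ r ^ 4 * (880 - 454 * r - 165 * r ^ 2 - 24 * r ^ 3 - 2 * r ^ 4) := by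
    refine mul_nonneg (by positivity) ?_
    have := pow_le_pow_left₀ hr hr1 2
    have := pow_le_pow_left₀ hr hr1 3
    have := pow_le_pow_left₀ hr hr1 4
    linarith
  have q2 := pow_nonneg hr 2
  have q3 := pow_nonneg hr 3
  have q4 := pow_nonneg hr 4
  have q5 := pow_nonneg hr 5
  have q6 := pow_nonneg hr 6
  have q7 := pow_nonneg hr 7
  have q8 := pow_nonneg hr 8
  ring_nf at h2 g1 g2
  linarith

theorem lower_ratio_line_four {r : ℝ} (hr : 0 ≤ r) (hr1 : r ≤ 683 / 1000) :
    (683 / 1000 - r) * ((1 - (677 / 2000 + 57 / 50 * r) / 4) ^ 4 +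
      (1 + (317 / 1000 + r) / 4) ^ 4 +
      (1 + (677 / 2000 + 57 / 50 * r - (317 / 1000 + r)) / 4) ^ 4) <
      3 * (1 - (677 / 2000 + 57 / 50 * r) / 4) ^ 4 := by
  have q2 := pow_nonneg hr 2
  have q3 := pow_nonneg hr 3
  have q5 := pow_nonneg hr 5
  have q4 : r ^ 4 ≤ 1 := pow_le_one₀ hr (by linarith)
  have q4' : 0 ≤ r ^ 3 * (683 / 1000 - r) := mul_nonneg q3 (by linarith)
  ring_nf at q4' ⊢
  linarith

theorem lower_ratio_line_three {r : ℝ} (hr : 0 ≤ r) (hr1 : r ≤ 683 / 1000) :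
    (683 / 1000 - r) * ((1 - (67 / 200 + 57 / 50 * r) / 3) ^ 3 +
      (1 + (317 / 1000 + r) / 3) ^ 3 +
      (1 + (67 / 200 + 57 / 50 * r - (317 / 1000 + r)) / 3) ^ 3) <
      3 * (1 - (67 / 200 + 57 / 50 * r) / 3) ^ 3 := by
  have q2 := pow_nonneg hr 2
  have q3 := pow_nonneg hr 3
  have q4' : 0 ≤ r ^ 3 * (683 / 1000 - r) := mul_nonneg q3 (by linarith)
  ring_nf at q4' ⊢
  linarith

/-- The ratio bound, given a line in the `(s, t)`-plane on which both bounds of a limiting box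
fail. -/
theorem IsLimitBox.ratio_lt_of_line {d₀ d : ℕ} {b l u c₀ : ℝ} (h : IsLimitBox d b l u)
    (hd₀ : 3 ≤ d₀) (hd : d₀ ≤ d) (hb0 : 0 < b) (hb1 : b < 1) (hb : b * (d + 1) ≤ 3)
    (hc : 317 / 1000 ≤ c₀) (hc' : c₀ ≤ 677 / 2000)
    (hup : ∀ r : ℝ, 0 ≤ r → r ≤ 683 / 1000 → 3 < (1 + (c₀ + 57 / 50 * r)) * (1 + 2 *
      √(upperRatio (1 / d) (317 / 1000 + r) (c₀ + 57 / 50 * r) ^ d)))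
    (hlow : ∀ r : ℝ, 0 ≤ r → r ≤ 683 / 1000 →
      (683 / 1000 - r) * ((1 - (c₀ + 57 / 50 * r) / d₀) ^ d₀ +
        (1 + (317 / 1000 + r) / d₀) ^ d₀ +
        (1 + (c₀ + 57 / 50 * r - (317 / 1000 + r)) / d₀) ^ d₀) <
        3 * (1 - (c₀ + 57 / 50 * r) / d₀) ^ d₀) :
    27 * u < 53 * l := by
  have hd3 : 3 ≤ d := hd₀.trans hd
  have hd' : (3 : ℝ) ≤ d := by exact_mod_cast hd3
  have hz0 : 0 < 1 / (d : ℝ) := by positivity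
  have hz3 : 1 / (d : ℝ) ≤ 1 / 3 := one_div_le_one_div_of_le (by norm_num) hd'
  have hU := h.upper_ratio hd3 hb0 hb1 hb
  have hlu := h.le
  have hL := fun t => h.lower_ratio_of_le (t := t) hd₀ hd hb0 hb1 hb
  have hL3 := fun t => h.lower_ratio_of_le (t := t) le_rfl hd3 hb0 hb1 hb
  obtain ⟨hl, hu, h1, h2, -, -⟩ := h
  obtain ⟨s, rfl⟩ : ∃ s, l = (1 - s) / 3 := ⟨1 - 3 * l, by ring⟩
  obtain ⟨t, rfl⟩ : ∃ t, u = (1 + t) / 3 := ⟨3 * u - 1, by ring⟩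
  have es : 1 - 3 * ((1 - s) / 3) = s := by ring
  have et : 3 * ((1 + t) / 3) - 1 = t := by ring
  have et' : 3 * ((1 + t) / 3) = 1 + t := by ring
  have es' : 3 * ((1 - s) / 3) = 1 - s := by ring
  rw [es, et, et'] at hU
  simp only [et, es', sub_sub_cancel] at hL hL3
  have hs0 : 0 ≤ s := by linarith
  have hs1 : s ≤ 1 := by linarith
  have ht0 : 0 ≤ t := by linarith
  have ht2 : t < 2 := by
    by_contra! h
    have ht : t = 2 := by linarith
    subst ht
    have := Real.sqrt_pos.2 (pow_pos (upperRatio_pos hz0 hz3 hs0 hs1 ht0 le_rfl) d)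
    linarith
  rcases le_total t s with hts | hst
  · have := hL3 s le_rfl hts (by linarith)
    push_cast at this
    have e : 0 ≤ -(s ^ 2 * (9 + 15 * s)) := by
      ring_nf at this ⊢
      linarith
    have : s ^ 2 * (9 + 15 * s) = 0 := le_antisymm (by linarith) (by positivity)
    have hs : s = 0 := by
      rcases mul_eq_zero.1 this with h | h
      · exact pow_eq_zero_iff two_ne_zero |>.1 h
      · linarith
    linarith
  · rcases le_total (317 / 1000) s with hs | hs
    · exfalso
      obtain ⟨r, rfl⟩ : ∃ r, s = 317 / 1000 + r := ⟨s - 317 / 1000, by ring⟩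
      have hr : 0 ≤ r := by linarith
      have hr1 : r ≤ 683 / 1000 := by linarith
      rcases le_total (c₀ + 57 / 50 * r) t with hct | htc
      · exact (hup r hr hr1).not_ge
          (upper_ratio_of_le hd3 hs0 (by linarith) hct ht2 hU)
      · refine (hlow r hr hr1).not_ge ?_
        have := hL _ (by linarith) htc (by linarith)
        rwa [show 1 - (317 / 1000 + r) = 683 / 1000 - r by ring] at this
    · have htc : t < c₀ := by
        by_contra! hct
        have h3 : (1 + t) * (1 + 2 * √(upperRatio (1 / d) (317 / 1000) t ^ d)) ≤ 3 := by
          refine le_trans (mul_le_mul_of_nonneg_left ?_ (by linarith)) hU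
          have := Real.sqrt_le_sqrt (pow_le_pow_left₀ (upperRatio_pos hz0 hz3 (by norm_num)
            (by norm_num) ht0 ht2.le).le
            (upperRatio_antitone hz0 hz3 hs0 hs (by norm_num) ht0 ht2.le) d)
          linarith
        have h4 := upper_ratio_of_le hd3 (by norm_num) hc hct ht2 h3
        have h5 := hup 0 le_rfl (by norm_num)
        simp only [mul_zero, add_zero] at h5
        linarith
      linarith

theorem IsLimitBox.ratio_lt {d : ℕ} {b l u : ℝ} (h : IsLimitBox d b l u) (hd : 3 ≤ d)
    (hb0 : 0 < b) (hb1 : b < 1) (hb : b * (d + 1) ≤ 3) : 27 * u < 53 * l := by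
  rcases hd.eq_or_lt with rfl | hd4
  · refine h.ratio_lt_of_line (c₀ := 67 / 200) le_rfl le_rfl hb0 hb1 hb (by norm_num) (by norm_num)
      (fun r => upper_ratio_line_three) fun r hr hr1 => ?_
    exact_mod_cast lower_ratio_line_three hr hr1
  · refine h.ratio_lt_of_line (d₀ := 4) (c₀ := 677 / 2000) (by norm_num) hd4 hb0 hb1 hb
      (by norm_num) le_rfl (fun r => upper_ratio_line_of_four_le hd4) fun r hr hr1 => ?_
    exact_mod_cast lower_ratio_line_four hr hr1

theorem mainTheorem8 :
    (∀ β : ℝ, 0 < β → β < 1 →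
      ∀ᶠ n : ℕ in atTop, ∀ (τ : DaryTree.leaves 2 n → Fin 3) (c : Fin 3),
        459 / 2000 ≤ DaryTree.rootMarginal 2 n β τ c ∧
          DaryTree.rootMarginal 2 n β τ c ≤ 1107 / 2500) ∧
    (∀ d : ℕ, 3 ≤ d → ∀ β : ℝ, 1 - 3 / ((d : ℝ) + 1) ≤ β → β < 1 →
      ∃ L U : ℕ → ℝ, ∀ᶠ n : ℕ in atTop,
        (∀ (τ : DaryTree.leaves d n → Fin 3) (c : Fin 3),
          L n ≤ DaryTree.rootMarginal d n β τ c ∧ DaryTree.rootMarginal d n β τ c ≤ U n) ∧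
        0 < L n ∧ U n / L n ≤ 53 / 27) := by
  constructor
  · intro β hβ0 hβ1
    obtain ⟨l, u, h, hlim⟩ := DaryTree.exists_isLimitBox_rootMarginal two_pos hβ0 hβ1
    obtain ⟨hl, hu⟩ := h.two_bounds (by linarith) (by linarith)
    filter_upwards [hlim (min (l - 459 / 2000) (1107 / 2500 - u))
      (lt_min (by linarith) (by linarith))] with n hn τ c
    obtain ⟨h1, h2⟩ := hn τ c
    exact ⟨by linarith [min_le_left (l - 459 / 2000) (1107 / 2500 - u)],
      by linarith [min_le_right (l - 459 / 2000) (1107 / 2500 - u)]⟩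
  · intro d hd β hβ hβ1
    have hd' : (3 : ℝ) ≤ d := by exact_mod_cast hd
    have hb : (1 - β) * (d + 1) ≤ 3 := by
      rw [← le_div_iff₀ (by linarith)]
      linarith
    have hβ0 : 0 < β := by nlinarith
    obtain ⟨l, u, h, hlim⟩ :=
      DaryTree.exists_isLimitBox_rootMarginal (by omega : 0 < d) hβ0 hβ1
    have hr := h.ratio_lt hd (by linarith) (by linarith) hb
    have hlu := h.le
    have hl := h.nonneg
    have hε : 0 < (53 * l - 27 * u) / 80 := by linarith
    refine ⟨fun _ => l - (53 * l - 27 * u) / 80, fun _ => u + (53 * l - 27 * u) / 80, ?_⟩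
    filter_upwards [hlim _ hε] with n hn
    have hpos : 0 < l - (53 * l - 27 * u) / 80 := by linarith
    refine ⟨hn, hpos, ?_⟩
    rw [div_le_div_iff₀ hpos (by norm_num)]
    linarith
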